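/- For $\beta\in\mathbb R^d$ and a probability distribution $E$ on $\mathbb R$ let $P_{\beta,E}$ be the law of $(x,y)\in\mathbb R^d\times\mathbb R$, where $x\sim\mathcal N(0,I_d)$ and $y=x^\top\beta+Z$ with $Z\sim E$ independent of $x$. A $\mathrm{VSTAT}(m)$ oracle ($m\in\mathbb N$, $m\ge 1$) for a distribution $D$ answers a measurable query $f$ with values in $[0,1]$ by any $v$ with $|v-\mathbb E_D f|\le\max\{1/m,\sqrt{\mathbb E_D f\,(1-\mathbb E_D f)/m}\}$. An SQ algorithm makes (possibly adaptive) queries to such an oracle for an unknown $D$; it must succeed for every choice of admissible answers. Theorem. There is an absolute constant $C>0$ such that the following holds for all $d\ge1$, $\alpha\in(0,1)$ and $\tau>0$ with $\tau\alpha\le1$ (in particular for all $\tau\in(0,1]$). There are an integer $1\le m\le C/\alpha$, a real $0<\eta\le C\tau\alpha$ and a deterministic SQ algorithm, depending only on $d,\alpha,\tau$, which makes $$q\le\exp\bigl(C\,d\log\tfrac1{\tau\alpha}\bigr)$$ queries to $\mathrm{VSTAT}(m)$. The algorithm has the following form: for each point $b_i$ of a finite $\eta$-net $b_1,\dots,b_q$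 of the unit ball, consisting of points of the ball, it queries $f_i(x,y)=\mathbf 1\{|x^\top b_i-y|\le\eta\}$, and it outputs a $b_j$ whose answer is largest. For every $\beta^*\in\mathbb R^d$ with $\|\beta^*\|_2\le1$ and every probability distribution $E$ on $\mathbb R$ with $E(\{0\})\ge\alpha$, both unknown to the algorithm: 1. for every sequence of admissible $\mathrm{VSTAT}(m)$ answers for $P_{\beta^*,E}$, the output $\widehat\beta$ satisfies $\|\widehat\beta-\beta^*\|_2\le C\tau$; 2. for all $\delta\in(0,1)$ and all integers $$n\ge C\,\frac{d\log(2/\alpha)+\log(1/\delta)}{\alpha},$$ with probability at least $1-\delta$ over $n$ i.i.d. samples from $P_{\beta^*,E}$, the empirical means over these samples are simultaneously admissible $\mathrm{VSTAT}(m)$ answers for $P_{\beta^*,E}$ to all the queries of the algorithm. Hence $\widetilde O(d/\alpha)$ samples, a number independent of $\tau$, suffice to simulate the oracle with high probability. -/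

import Mathlib

open MeasureTheory ProbabilityTheory

noncomputable section

/-- The covariate space `ℝ^d` with the Euclidean norm. -/
abbrev Covariate (d : ℕ) : Type := EuclideanSpace ℝ (Fin d)

/-- Labeled examples `(x, y) ∈ ℝ^d × ℝ`. -/
abbrev Example (d : ℕ) : Type := Covariate d × ℝ

/-- The law `P_{β,E}` of `(x, xᵀβ + Z)`, where `x ∼ N(0, I_d)` and `Z ∼ E` are independent. -/
def obliviousLaw {d : ℕ} (β : Covariate d) (E : Measure ℝ) : Measure (Example d) :=
  ((stdGaussian (Covariate d)).prod E).map (fun p => (p.1, inner ℝ p.1 β + p.2))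

/-- A statistical query: a measurable function with values in `[0, 1]`. -/
structure StatQuery (X : Type) [MeasurableSpace X] where
  toFun : X → ℝ
  measurable_toFun : Measurable toFun
  nonneg : ∀ x, 0 ≤ toFun x
  le_one : ∀ x, toFun x ≤ 1

/-- `v` is an admissible answer of a `VSTAT(m)` oracle for `D` to the query `f`:
`|v - E_D f| ≤ max {1/m, √(E_D f (1 - E_D f) / m)}` (used with `1 ≤ m`). -/
def IsVSTATAnswer {X : Type} [MeasurableSpace X] (D : Measure X) (m : ℕ) (f : StatQuery X)
    (v : ℝ) : Prop :=
  |v - ∫ x, f.toFun x ∂D| ≤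
    max (1 / (m : ℝ)) (Real.sqrt ((∫ x, f.toFun x ∂D) * (1 - ∫ x, f.toFun x ∂D) / m))

/-- A deterministic, possibly adaptive, SQ algorithm: the `i`-th query is a function of the
answers to the previous queries, and the output is a function of all the answers. -/
structure SQAlgorithm (X : Type) [MeasurableSpace X] (Θ : Type) where
  numQueries : ℕ
  query : (i : Fin numQueries) → (Fin i → ℝ) → StatQuery X
  output : (Fin numQueries → ℝ) → Θ

namespace SQAlgorithm

variable {X : Type} [MeasurableSpace X] {Θ : Type}

/-- The `i`-th query asked, when the answers received are recorded in `v`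
(only the entries of `v` before `i` matter). -/
def queryAt (A : SQAlgorithm X Θ) (v : Fin A.numQueries → ℝ) (i : Fin A.numQueries) :
    StatQuery X :=
  A.query i (fun j => v ⟨j, j.2.trans i.2⟩)

/-- `v` is a possible sequence of answers of some `VSTAT(m)` oracle for `D` in an execution
of `A`: each answer is admissible for the query it answers, and nothing else is required. -/
def IsVSTATTranscript (A : SQAlgorithm X Θ) (D : Measure X) (m : ℕ)
    (v : Fin A.numQueries → ℝ) : Prop :=
  ∀ i, IsVSTATAnswer D m (A.queryAt v i) (v i)

/-- The `i`-th answer received when `A` is run with every query `f` answered by `o f`. -/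
def answer (A : SQAlgorithm X Θ) (o : StatQuery X → ℝ) (i : ℕ) (hi : i < A.numQueries) : ℝ :=
  o (A.query ⟨i, hi⟩ (fun j => A.answer o j (j.2.trans hi)))
termination_by i
decreasing_by exact j.2

/-- All the answers received when `A` is run with every query `f` answered by `o f`. -/
def run (A : SQAlgorithm X Θ) (o : StatQuery X → ℝ) : Fin A.numQueries → ℝ :=
  fun i => A.answer o i i.2

theorem run_apply (A : SQAlgorithm X Θ) (o : StatQuery X → ℝ) (i : Fin A.numQueries) :
    A.run o i = o (A.queryAt (A.run o) i) := by
  unfold run queryAt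
  rw [answer]

end SQAlgorithm

/-- The empirical mean of a query over the sample `s`. -/
def empiricalMean {X : Type} [MeasurableSpace X] {n : ℕ} (s : Fin n → X) (f : StatQuery X) : ℝ :=
  (∑ i, f.toFun (s i)) / n

/-- The interval-indicator query `(x, y) ↦ 1{|xᵀβ - y| ≤ η}`. -/
def intervalIndicator {d : ℕ} (β : Covariate d) (η : ℝ) : Example d → ℝ :=
  Set.indicator {p | |inner ℝ p.1 β - p.2| ≤ η} 1

/-- `A` asks, non-adaptively, the interval-indicator queries of half-width `η` of the points of
a finite `η`-net of the unit ball (contained in the ball), one query for each point, and outputs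
a point of the net whose answer is largest. -/
def SQAlgorithm.MaximizesOverNet {d : ℕ} (A : SQAlgorithm (Example d) (Covariate d)) (η : ℝ) :
    Prop :=
  ∃ b : Fin A.numQueries → Covariate d,
    (∀ i, ‖b i‖ ≤ 1) ∧
    (∀ β : Covariate d, ‖β‖ ≤ 1 → ∃ i, ‖b i - β‖ ≤ η) ∧
    (∀ v i, (A.queryAt v i).toFun = intervalIndicator (b i) η) ∧
    (∀ v, ∃ j, A.output v = b j ∧ ∀ i, v i ≤ v j)

end

/-! Accuracy. Under `P_{β,E}` the residual `xᵀb - y` equals `xᵀ(b - β) - Z`. If `b` is within `η/2`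
of `β`, the atom of `E` at `0` alone gives the slab of half-width `η` mass at least `3α/4`. If `b ≠
β`, the Gaussian density bound gives mass at most `η/‖b - β‖`, whatever `E` is
(`le_obliviousLaw_real_slab`, `obliviousLaw_real_slab_le`). With `η = τα`, a point farther than
`100τ` from `β` has mass at most `α/100`. For `m` of order `1/α` the oracle error cannot close this
gap, so no maximizer is far (`netAlgorithm_output_close`).

Sampling. A union bound over the net would bring `log (1/τ)` into the sample size. Instead, on `2n`
points the slabs leave only `(∑_{k ≤ d} (2n choose k))²` traces, however many there are, because a
slab is an intersection of two halfspaces and halfspace traces are controlled by Sauer–Shelah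
(`card_slab_traces_le`). A ghost sample and random swaps within pairs reduce the deviation to
self-normalized Rademacher sums, one per trace. Self-normalization yields the variance-sensitive
tolerance of `VSTAT`, and hence the rate `1/α` instead of `1/α²`
(`measure_exists_vstatTolerance_lt_le`). -/

/-! ### Rademacher sums -/

/-- The sign `±1` encoded by a Boolean. -/
def boolSign (b : Bool) : ℝ := if b then 1 else -1

/-- The sum factors over coordinates, and each factor is controlled by `cosh u ≤ exp (u²/2)`. -/
theorem sum_exp_rademacher_le {n : ℕ} (a : Fin n → ℝ) (l : ℝ) :
    ∑ σ : Fin n → Bool, Real.exp (l * ∑ k, boolSign (σ k) * a k) ≤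
      2 ^ n * Real.exp (l ^ 2 / 2 * ∑ k, a k ^ 2) := by
  have h1 : ∑ σ : Fin n → Bool, Real.exp (l * ∑ k, boolSign (σ k) * a k) =
      ∏ k, ∑ b : Bool, Real.exp (l * (boolSign b * a k)) := by
    rw [Finset.prod_univ_sum, Fintype.piFinset_univ]
    refine Finset.sum_congr rfl fun σ _ => ?_
    rw [Finset.mul_sum, Real.exp_sum]
  have h2 : (2 : ℝ) ^ n * Real.exp (l ^ 2 / 2 * ∑ k, a k ^ 2) =
      ∏ k : Fin n, (2 * Real.exp ((l * a k) ^ 2 / 2)) := by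
    rw [Finset.prod_mul_distrib, ← Real.exp_sum, Finset.mul_sum]
    simp only [Finset.prod_const, Finset.card_univ, Fintype.card_fin]
    congr 2
    exact Finset.sum_congr rfl fun k _ => by ring
  rw [h1, h2]
  refine Finset.prod_le_prod (fun k _ => by positivity) fun k _ => ?_
  have h := Real.cosh_le_exp_half_sq (l * a k)
  rw [Real.cosh_eq] at h
  simp only [Fintype.sum_bool, boolSign, if_true, Bool.false_eq_true, if_false, one_mul]
  rw [show l * (-1 * a k) = -(l * a k) by ring]
  linarith

/-- Chernoff bound with the optimal parameter `l = s / V`: the threshold contributes `l s = c`, the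
moment generating function costs `l² V / 2 = c / 2`. -/
theorem card_rademacher_ge_le {n : ℕ} (a : Fin n → ℝ) {c : ℝ} (hc : 0 ≤ c)
    (hV : 0 < ∑ k, a k ^ 2) :
    ((Finset.univ.filter fun σ : Fin n → Bool =>
      Real.sqrt (c * ∑ k, a k ^ 2) ≤ ∑ k, boolSign (σ k) * a k).card : ℝ) ≤
      2 ^ n * Real.exp (-c / 2) := by
  set V := ∑ k, a k ^ 2 with hVdef
  set s := Real.sqrt (c * V) with hs
  have hs0 : 0 ≤ s := Real.sqrt_nonneg _
  have hss : s ^ 2 = c * V := Real.sq_sqrt (by positivity)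
  have h := sum_exp_rademacher_le a (s / V)
  have h2 : ((Finset.univ.filter fun σ : Fin n → Bool =>
      s ≤ ∑ k, boolSign (σ k) * a k).card : ℝ) * Real.exp c ≤
      ∑ σ : Fin n → Bool, Real.exp (s / V * ∑ k, boolSign (σ k) * a k) := by
    rw [← nsmul_eq_mul]
    refine (Finset.card_nsmul_le_sum _ _ _ fun σ hσ => ?_).trans
      (Finset.sum_le_sum_of_subset_of_nonneg (Finset.filter_subset _ _)
        fun _ _ _ => (Real.exp_pos _).le)
    rw [Finset.mem_filter] at hσ
    refine Real.exp_le_exp.2 ?_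
    calc c = s / V * s := by field_simp; linarith
      _ ≤ _ := mul_le_mul_of_nonneg_left hσ.2 (by positivity)
  have h3 : (s / V) ^ 2 / 2 * V = c / 2 := by
    rw [div_pow, hss]; field_simp
  rw [← hVdef, h3] at h
  have h4 : Real.exp (-c / 2) * Real.exp c = Real.exp (c / 2) := by
    rw [← Real.exp_add]; congr 1; ring
  refine le_of_mul_le_mul_right ?_ (Real.exp_pos c)
  rw [mul_assoc, h4]
  exact h2.trans h

/-- Self-normalized Hoeffding bound for Rademacher sums. -/
theorem card_rademacher_sq_ge_le {n : ℕ} (a : Fin n → ℝ) {c : ℝ} (hc : 0 ≤ c) :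
    ((Finset.univ.filter fun σ : Fin n → Bool =>
      ∑ k, boolSign (σ k) * a k ≠ 0 ∧
        c * ∑ k, a k ^ 2 ≤ (∑ k, boolSign (σ k) * a k) ^ 2).card : ℝ) ≤
      2 * (2 ^ n * Real.exp (-c / 2)) := by
  have hV0 : 0 ≤ ∑ k, a k ^ 2 := Finset.sum_nonneg fun k _ => sq_nonneg _
  -- If all `a k` vanish, the inequality in the event is `0 ≤ 0`; the clause `≠ 0` is what makes the
  -- event empty.
  rcases hV0.eq_or_lt with hV | hV
  · have ha : ∀ k, a k = 0 := fun k => by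
      have := (Finset.sum_eq_zero_iff_of_nonneg fun k _ => sq_nonneg (a k)).1 hV.symm k
        (Finset.mem_univ k)
      exact pow_eq_zero_iff two_ne_zero |>.1 this
    simp only [ha, mul_zero, Finset.sum_const_zero, ne_eq, not_true_eq_false, false_and,
      Finset.filter_false, Finset.card_empty, Nat.cast_zero]
    positivity
  have h1 := card_rademacher_ge_le a hc hV
  have h2 := card_rademacher_ge_le (fun k => -a k) hc (by simpa using hV)
  simp only [mul_neg, Finset.sum_neg_distrib, neg_sq] at h2
  refine le_trans ?_ ((add_le_add h1 h2).trans_eq (by ring))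
  rw [← Nat.cast_add, Nat.cast_le]
  refine le_trans (Finset.card_le_card ?_) (Finset.card_union_le _ _)
  intro σ hσ
  simp only [Finset.mem_filter, Finset.mem_univ, true_and, Finset.mem_union] at hσ ⊢
  have := Real.sqrt_le_sqrt hσ.2
  rw [Real.sqrt_sq_eq_abs] at this
  exact le_abs.1 this

/-! ### Traces of halfspaces and slabs -/

section Traces

variable {E ι κ : Type*} [NormedAddCommGroup E] [InnerProductSpace ℝ E] [FiniteDimensional ℝ E]
  [Fintype ι] [Fintype κ] [DecidableEq κ]

-- A Radon-type argument. More than `finrank` normals satisfy a relation `∑ g j • a j = 0`, with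
-- some `g j > 0` after a change of sign. Shattering supplies a point on the lower side exactly
-- where `g ≤ 0`, and one on the lower side exactly where `0 ≤ g`. The first forces `∑ g j * t j <
-- 0`, the second `0 ≤ ∑ g j * t j`.
open scoped Classical in
theorem card_le_finrank_of_shatters_halfspaces (b : ι → E) (a : κ → E) (t : κ → ℝ)
    {s : Finset κ}
    (hs : (Finset.univ.image fun i => Finset.univ.filter fun j =>
      inner ℝ (a j) (b i) ≤ t j).Shatters s) :
    s.card ≤ Module.finrank ℝ E := by
  by_contra! hcard
  have hdep : ¬ LinearIndepOn ℝ a (s : Set κ) := fun h => by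
    have := LinearIndependent.fintype_card_le_finrank h
    simp at this
    omega
  obtain ⟨g, hg0, hgne⟩ := not_linearIndepOn_finset_iff.1 hdep
  have hrel : ∀ x : E, ∑ j ∈ s, g j * inner ℝ (a j) x = 0 := fun x => by
    have := congrArg (fun v => inner ℝ v x) hg0
    simpa [sum_inner, inner_smul_left] using this
  have key : ∀ g : κ → ℝ, (∀ x : E, ∑ j ∈ s, g j * inner ℝ (a j) x = 0) →
      (∃ j ∈ s, 0 < g j) → False := by
    intro g hrel ⟨j₀, hj₀, hpos⟩
    have hpat : ∀ u, u ⊆ s → ∃ i, ∀ j ∈ s, (inner ℝ (a j) (b i) ≤ t j ↔ j ∈ u) := by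
      intro u hu
      obtain ⟨w, hw, hsw⟩ := hs hu
      obtain ⟨i, -, rfl⟩ := Finset.mem_image.1 hw
      refine ⟨i, fun j hj => ?_⟩
      rw [← hsw]
      simp [hj]
    obtain ⟨i₁, h₁⟩ := hpat (s.filter fun j => g j ≤ 0) (Finset.filter_subset _ _)
    obtain ⟨i₂, h₂⟩ := hpat (s.filter fun j => 0 ≤ g j) (Finset.filter_subset _ _)
    have e₁ : ∑ j ∈ s, g j * t j < ∑ j ∈ s, g j * inner ℝ (a j) (b i₁) := by
      refine Finset.sum_lt_sum (fun j hj => ?_) ⟨j₀, hj₀, ?_⟩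
      · by_cases hg : g j ≤ 0
        · have := (h₁ j hj).2 (by simp [hj, hg])
          nlinarith
        · have : ¬ inner ℝ (a j) (b i₁) ≤ t j := fun h => by
            simpa [hj, hg] using (h₁ j hj).1 h
          nlinarith
      · have : ¬ inner ℝ (a j₀) (b i₁) ≤ t j₀ := fun h => by
          have := (h₁ j₀ hj₀).1 h
          simp only [Finset.mem_filter] at this
          linarith [this.2]
        push Not at this
        exact mul_lt_mul_of_pos_left this hpos
    have e₂ : ∑ j ∈ s, g j * inner ℝ (a j) (b i₂) ≤ ∑ j ∈ s, g j * t j := by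
      refine Finset.sum_le_sum fun j hj => ?_
      by_cases hg : 0 ≤ g j
      · exact mul_le_mul_of_nonneg_left ((h₂ j hj).2 (by simp [hj, hg])) hg
      · have : ¬ inner ℝ (a j) (b i₂) ≤ t j := fun h => by
          simpa [hj, hg] using (h₂ j hj).1 h
        nlinarith
    rw [hrel] at e₁ e₂
    linarith
  obtain ⟨j₀, hj₀, hne⟩ := hgne
  rcases lt_or_gt_of_ne hne with h | h
  · exact key (fun j => -g j) (fun x => by simpa using hrel x) ⟨j₀, hj₀, by simpa using h⟩
  · exact key g hrel ⟨j₀, hj₀, h⟩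

/-- Weighting the terms by powers of `x = d / N ≤ 1` bounds `x ^ d` times the sum by `(1 + x) ^ N ≤
exp d`. -/
theorem sum_choose_le_exp_pow {d N : ℕ} (hd : 1 ≤ d) (hdN : d ≤ N) :
    ((∑ k ∈ Finset.Iic d, N.choose k : ℕ) : ℝ) ≤ (Real.exp 1 * N / d) ^ d := by
  have hd0 : (0 : ℝ) < d := by exact_mod_cast hd
  have hN0 : (0 : ℝ) < N := by exact_mod_cast hd.trans hdN
  set x : ℝ := d / N with hx
  have hx0 : 0 < x := by positivity
  have hx1 : x ≤ 1 := (div_le_one hN0).2 (by exact_mod_cast hdN)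
  have h1 : ((∑ k ∈ Finset.Iic d, N.choose k : ℕ) : ℝ) * x ^ d ≤ (x + 1) ^ N := by
    rw [add_pow, Nat.cast_sum, Finset.sum_mul]
    calc ∑ k ∈ Finset.Iic d, (N.choose k : ℝ) * x ^ d
        ≤ ∑ k ∈ Finset.Iic d, x ^ k * 1 ^ (N - k) * (N.choose k : ℝ) := by
          refine Finset.sum_le_sum fun k hk => ?_
          rw [one_pow, mul_one, mul_comm]
          exact mul_le_mul_of_nonneg_right
            (pow_le_pow_of_le_one hx0.le hx1 (Finset.mem_Iic.1 hk)) (Nat.cast_nonneg _)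
      _ ≤ _ := by
          refine Finset.sum_le_sum_of_subset_of_nonneg (fun k hk => ?_)
            fun k _ _ => by positivity
          rw [Finset.mem_Iic] at hk
          rw [Finset.mem_range]
          omega
  have h2 : (x + 1) ^ N ≤ Real.exp 1 ^ d := by
    calc (x + 1) ^ N ≤ Real.exp x ^ N :=
          pow_le_pow_left₀ (by positivity) (Real.add_one_le_exp x) _
      _ = Real.exp 1 ^ d := by
          rw [← Real.exp_nat_mul, ← Real.exp_nat_mul]
          congr 1
          rw [hx]
          field_simp
  have h3 : (Real.exp 1 * N / d) ^ d * x ^ d = Real.exp 1 ^ d := by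
    rw [← mul_pow]
    congr 1
    rw [hx]
    field_simp
  refine le_of_mul_le_mul_right ?_ (pow_pos hx0 d)
  rw [h3]
  exact h1.trans h2

open scoped Classical in
theorem card_halfspace_traces_le (b : ι → E) (a : κ → E) (t : κ → ℝ) :
    (Finset.univ.image fun i => Finset.univ.filter fun j =>
      inner ℝ (a j) (b i) ≤ t j).card ≤
      ∑ k ∈ Finset.Iic (Module.finrank ℝ E), (Fintype.card κ).choose k := by
  refine (Finset.card_le_card_shatterer _).trans (Finset.card_shatterer_le_sum_vcDim.trans ?_)
  refine Finset.sum_le_sum_of_subset (Finset.Iic_subset_Iic.2 ?_)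
  exact Finset.sup_le fun s hs =>
    card_le_finrank_of_shatters_halfspaces b a t (Finset.mem_shatterer.1 hs)

-- A slab is the intersection of two halfspaces with opposite normals, so its traces are
-- intersections of two halfspace traces.
open scoped Classical in
theorem card_slab_traces_le (b : ι → E) (x : κ → E) (y : κ → ℝ) (η : ℝ) :
    (Finset.univ.image fun i => Finset.univ.filter fun j =>
      |inner ℝ (x j) (b i) - y j| ≤ η).card ≤
      (∑ k ∈ Finset.Iic (Module.finrank ℝ E), (Fintype.card κ).choose k) ^ 2 := by
  set 𝒜 := Finset.univ.image fun i => Finset.univ.filter fun j =>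
    inner ℝ (x j) (b i) ≤ y j + η
  set ℬ := Finset.univ.image fun i => Finset.univ.filter fun j =>
    inner ℝ (-x j) (b i) ≤ -y j + η
  calc _ ≤ (Finset.image₂ (· ∩ ·) 𝒜 ℬ).card := by
        refine Finset.card_le_card fun s hs => ?_
        obtain ⟨i, -, rfl⟩ := Finset.mem_image.1 hs
        refine Finset.mem_image₂.2 ⟨_, Finset.mem_image_of_mem _ (Finset.mem_univ i),
          _, Finset.mem_image_of_mem _ (Finset.mem_univ i), ?_⟩
        ext j
        simp only [Finset.mem_inter, Finset.mem_filter, Finset.mem_univ, true_and, inner_neg_left,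
          abs_le]
        constructor <;> rintro ⟨h, h'⟩ <;> constructor <;> linarith
    _ ≤ 𝒜.card * ℬ.card := Finset.card_image₂_le _ _ _
    _ ≤ _ := by
        rw [sq]
        exact Nat.mul_le_mul (card_halfspace_traces_le b _ _) (card_halfspace_traces_le b _ _)

end Traces

/-! ### Uniform relative deviation bounds -/

section RelativeDeviation

variable {X : Type*}

/-- Empirical frequency of a set in a sample. -/
noncomputable def empiricalFreq {n : ℕ} (S : Set X) (s : Fin n → X) : ℝ :=
  (∑ k, S.indicator (1 : X → ℝ) (s k)) / n

theorem measurable_empiricalFreq [MeasurableSpace X] {n : ℕ} {S : Set X} (hS : MeasurableSet S) :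
    Measurable (empiricalFreq (n := n) S) := by
  unfold empiricalFreq
  have : Measurable (S.indicator (1 : X → ℝ)) := measurable_one.indicator hS
  fun_prop

/-- Chebyshev's inequality for empirical frequencies. -/
theorem measure_empiricalFreq_sub_ge_le [MeasurableSpace X] (μ : Measure X)
    [IsProbabilityMeasure μ] {n : ℕ} (hn : 0 < n) {S : Set X} (hS : MeasurableSet S) {t : ℝ} (ht : 0 < t) :
    Measure.pi (fun _ : Fin n => μ) {s | t ≤ |empiricalFreq S s - μ.real S|} ≤
      ENNReal.ofReal (μ.real S * (1 - μ.real S) / (n * t ^ 2)) := by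
  set f : X → ℝ := S.indicator 1 with hf
  have hfm : Measurable f := measurable_one.indicator hS
  have hfL : MemLp f 2 μ :=
    MemLp.of_bound hfm.aestronglyMeasurable 1 (ae_of_all _ fun x => by
      by_cases hx : x ∈ S <;> simp [hf, hx])
  have hn0 : (n : ℝ) ≠ 0 := by positivity
  have hint : ∫ x, f x ∂μ = μ.real S := by rw [hf, integral_indicator_one hS]
  have hvar : Var[f; μ] = μ.real S * (1 - μ.real S) := by
    rw [variance_eq_sub hfL]
    have : f ^ 2 = f := by
      ext x
      by_cases hx : x ∈ S <;> simp [hf, hx]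
    rw [this, hint]
    ring
  have hEi : ∀ k : Fin n, ∫ s : Fin n → X, f (s k) ∂(Measure.pi fun _ => μ) = μ.real S :=
    fun k => by rw [integral_comp_eval hfm.aestronglyMeasurable, hint]
  have hmemi : ∀ k : Fin n, MemLp (fun s : Fin n → X => f (s k)) 2 (Measure.pi fun _ => μ) :=
    fun k => hfL.comp_measurePreserving (measurePreserving_eval (fun _ : Fin n => μ) k)
  have hE : ∫ s, empiricalFreq S s ∂(Measure.pi fun _ : Fin n => μ) = μ.real S := by
    unfold empiricalFreq
    rw [integral_div, integral_finsetSum _ fun k _ => (hmemi k).integrable (by norm_num)]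
    rw [Finset.sum_congr rfl fun k _ => hEi k]
    simp [hn0]
  have hsum : Var[∑ k : Fin n, fun s : Fin n → X => f (s k); Measure.pi fun _ => μ] =
      n * (μ.real S * (1 - μ.real S)) := by
    rw [variance_sum_pi (fun _ => hfL)]
    simp [hvar]
  have hfun : empiricalFreq (n := n) S =
      fun s => (n : ℝ)⁻¹ * (∑ k : Fin n, fun s : Fin n → X => f (s k)) s := by
    ext s
    simp only [empiricalFreq, Finset.sum_apply, ← hf]
    ring
  have hV : Var[empiricalFreq S; Measure.pi fun _ : Fin n => μ] =
      μ.real S * (1 - μ.real S) / n := by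
    rw [hfun, variance_const_mul, hsum]
    field_simp
  have hmem : MemLp (empiricalFreq S) 2 (Measure.pi fun _ : Fin n => μ) := by
    rw [hfun]
    exact (memLp_finsetSum' _ fun k _ => hmemi k).const_mul _
  have := meas_ge_le_variance_div_sq hmem ht
  rw [hE, hV, div_div] at this
  exact this

/-- If the frequency of `S` deviates from `p` on one sample but not on a second one, then the
difference of the two counts is large compared with the number of disagreements. -/
theorem sq_freq_sub_ge {m n : ℕ} (hm : 1 ≤ m) (hn : 0 < n) {S : Set X} {p t : ℝ}
    (h1 : 1 / (m : ℝ) ≤ t) (h2 : p * (1 - p) / m ≤ t ^ 2) (hp0 : 0 ≤ p) (hp1 : p ≤ 1)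
    {s s' : Fin n → X} (hs : t < |empiricalFreq S s - p|)
    (hs' : |empiricalFreq S s' - p| < t / 2) :
    ∑ k, (S.indicator (1 : X → ℝ) (s k) - S.indicator (1 : X → ℝ) (s' k)) ≠ 0 ∧
      n / (22 * m) * ∑ k, (S.indicator (1 : X → ℝ) (s k) - S.indicator (1 : X → ℝ) (s' k)) ^ 2 ≤
      (∑ k, (S.indicator (1 : X → ℝ) (s k) - S.indicator (1 : X → ℝ) (s' k))) ^ 2 := by
  set f : X → ℝ := S.indicator 1 with hf
  have hn0 : (0 : ℝ) < n := by exact_mod_cast hn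
  have hm0 : (0 : ℝ) < m := by exact_mod_cast hm
  have ht : 0 < t := lt_of_lt_of_le (by positivity) h1
  set F := empiricalFreq S s with hF
  set F' := empiricalFreq S s' with hF'
  have hFs : ∑ k, f (s k) = n * F := by rw [hF, empiricalFreq]; field_simp; rfl
  have hFs' : ∑ k, f (s' k) = n * F' := by rw [hF', empiricalFreq]; field_simp; rfl
  have hT : ∑ k, (f (s k) - f (s' k)) = n * (F - F') := by
    rw [Finset.sum_sub_distrib, hFs, hFs']; ring
  have hV1 : ∑ k, (f (s k) - f (s' k)) ^ 2 ≤ n * (F + F') := by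
    rw [mul_add, ← hFs, ← hFs', ← Finset.sum_add_distrib]
    refine Finset.sum_le_sum fun k _ => ?_
    by_cases h : s k ∈ S <;> by_cases h' : s' k ∈ S <;> simp [hf, h, h']
  have hV2 : ∑ k, (f (s k) - f (s' k)) ^ 2 ≤ n * (2 - F - F') := by
    have : (n : ℝ) * (2 - F - F') = ∑ k : Fin n, (2 - f (s k) - f (s' k)) := by
      rw [Finset.sum_sub_distrib, Finset.sum_sub_distrib, hFs, hFs']; simp; ring
    rw [this]
    refine Finset.sum_le_sum fun k _ => ?_
    by_cases h : s k ∈ S <;> by_cases h' : s' k ∈ S <;> simp [hf, h, h'] <;> norm_num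
  set V := ∑ k, (f (s k) - f (s' k)) ^ 2
  have hD : t / 2 < |F - F'| := by
    have := abs_sub_le F F' p
    linarith
  set D := |F - F'| with hDdef
  have hD0 : 0 < D := by linarith
  have hD2 : D ^ 2 = (F - F') ^ 2 := sq_abs _
  have hDle : D ≤ 2 * m * D ^ 2 := by
    have : 1 / (m : ℝ) ≤ 2 * D := by linarith
    rw [div_le_iff₀ hm0] at this
    nlinarith
  have hpq : p * (1 - p) ≤ 4 * m * D ^ 2 := by
    rw [div_le_iff₀ hm0] at h2
    have : t ^ 2 ≤ 4 * D ^ 2 := by nlinarith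
    nlinarith
  have a1 := abs_le.1 hs'.le
  have a2 := le_abs_self (F - F')
  have a3 := neg_abs_le (F - F')
  rw [← hDdef] at a2 a3
  -- For `p ≤ 1/2`: `p ≤ 2p(1 - p) ≤ 8mD²`, `F' ≤ p + D` and `F ≤ p + 2D`, so `F + F' ≤ 2p + 3D ≤
  -- 16mD² + 6mD²`. The case `p ≥ 1/2` is the same for the complement.
  have hVD : V ≤ n * (22 * m * D ^ 2) := by
    rcases le_total p (1 / 2) with h | h
    · refine hV1.trans (mul_le_mul_of_nonneg_left ?_ hn0.le)
      nlinarith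
    · refine hV2.trans (mul_le_mul_of_nonneg_left ?_ hn0.le)
      nlinarith
  rw [hT]
  refine ⟨mul_ne_zero hn0.ne' (abs_pos.1 hD0), ?_⟩
  rw [mul_pow, ← hD2]
  calc (n : ℝ) / (22 * m) * V ≤ n / (22 * m) * (n * (22 * m * D ^ 2)) :=
        mul_le_mul_of_nonneg_left hVD (by positivity)
    _ = _ := by field_simp

/-- Exchange the two entries of the `k`-th pair unless `σ k`. -/
def swapPairs {n : ℕ} (σ : Fin n → Bool) (w : Fin n → X × X) : Fin n → X × X :=
  fun k => if σ k then w k else (w k).swap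

theorem measurePreserving_swapPairs [MeasurableSpace X] (μ : Measure X) [IsProbabilityMeasure μ] {n : ℕ}
    (σ : Fin n → Bool) :
    MeasurePreserving (swapPairs σ) (Measure.pi fun _ : Fin n => μ.prod μ)
      (Measure.pi fun _ : Fin n => μ.prod μ) := by
  have h : ∀ k, MeasurePreserving (fun z : X × X => if σ k then z else z.swap)
      (μ.prod μ) (μ.prod μ) := fun k => by
    cases σ k
    · exact Measure.measurePreserving_swap
    · exact MeasurePreserving.id _
  exact measurePreserving_pi _ _ h

/-- The event that the count of `S` differs between the two halves of a double sample by more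
than `√c` times the root of the number of disagreements. -/
def selfNormalizedEvent {n : ℕ} (S : Set X) (c : ℝ) : Set (Fin n → X × X) :=
  {w | ∑ k, (S.indicator (1 : X → ℝ) (w k).1 - S.indicator (1 : X → ℝ) (w k).2) ≠ 0 ∧
    c * ∑ k, (S.indicator (1 : X → ℝ) (w k).1 - S.indicator (1 : X → ℝ) (w k).2) ^ 2 ≤
      (∑ k, (S.indicator (1 : X → ℝ) (w k).1 - S.indicator (1 : X → ℝ) (w k).2)) ^ 2}

theorem measurableSet_selfNormalizedEvent [MeasurableSpace X] {n : ℕ} {S : Set X} (hS : MeasurableSet S) (c : ℝ) :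
    MeasurableSet (selfNormalizedEvent (n := n) S c) := by
  have : Measurable (S.indicator (1 : X → ℝ)) := measurable_one.indicator hS
  have hd : Measurable fun w : Fin n → X × X =>
      ∑ k, (S.indicator (1 : X → ℝ) (w k).1 - S.indicator (1 : X → ℝ) (w k).2) := by fun_prop
  have hq : Measurable fun w : Fin n → X × X =>
      c * ∑ k, (S.indicator (1 : X → ℝ) (w k).1 - S.indicator (1 : X → ℝ) (w k).2) ^ 2 := by
    fun_prop
  exact (measurableSet_eq_fun hd measurable_const).compl.inter
    (measurableSet_le hq (hd.pow_const 2))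

theorem swapPairs_mem_selfNormalizedEvent {n : ℕ} (S : Set X) (c : ℝ) (σ : Fin n → Bool)
    (w : Fin n → X × X) :
    swapPairs σ w ∈ selfNormalizedEvent S c ↔
      ∑ k, boolSign (σ k) *
        (S.indicator (1 : X → ℝ) (w k).1 - S.indicator (1 : X → ℝ) (w k).2) ≠ 0 ∧
      c * ∑ k, (S.indicator (1 : X → ℝ) (w k).1 - S.indicator (1 : X → ℝ) (w k).2) ^ 2 ≤
        (∑ k, boolSign (σ k) *
          (S.indicator (1 : X → ℝ) (w k).1 - S.indicator (1 : X → ℝ) (w k).2)) ^ 2 := by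
  have h : ∀ k, S.indicator (1 : X → ℝ) (swapPairs σ w k).1 -
      S.indicator (1 : X → ℝ) (swapPairs σ w k).2 = boolSign (σ k) *
        (S.indicator (1 : X → ℝ) (w k).1 - S.indicator (1 : X → ℝ) (w k).2) := fun k => by
    by_cases hk : σ k = true <;> simp [swapPairs, boolSign, hk]
  have h2 : ∀ k, boolSign (σ k) ^ 2 = 1 := fun k => by
    by_cases hk : σ k = true <;> simp [boolSign, hk]
  simp only [selfNormalizedEvent, Set.mem_ofPred_eq, h, mul_pow, h2, one_mul]

variable {ι : Type*} [Fintype ι]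

-- For a fixed double sample, swapping pairs only multiplies the differences by signs. These
-- differences depend on `S i` only through its trace on the `2n` points, so the union bound runs
-- over at most `K` traces and not over the index type.
open scoped Classical in
theorem card_swapPairs_mem_le {n K : ℕ} (S : ι → Set X)
    (hK : ∀ z : Fin n × Bool → X,
      (Finset.univ.image fun i => Finset.univ.filter fun j => z j ∈ S i).card ≤ K)
    {c : ℝ} (hc : 0 ≤ c) (w : Fin n → X × X) :
    ((Finset.univ.filter fun σ : Fin n → Bool =>
      swapPairs σ w ∈ ⋃ i, selfNormalizedEvent (S i) c).card : ℝ) ≤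
      2 ^ n * (2 * K * Real.exp (-c / 2)) := by
  set z : Fin n × Bool → X := fun j => if j.2 then (w j.1).1 else (w j.1).2 with hz
  set 𝒜 := Finset.univ.image fun i => Finset.univ.filter fun j => z j ∈ S i with h𝒜
  set a : Finset (Fin n × Bool) → Fin n → ℝ := fun A k =>
    (if (k, true) ∈ A then 1 else 0) - (if (k, false) ∈ A then 1 else 0) with ha
  have hai : ∀ i k, a (Finset.univ.filter fun j => z j ∈ S i) k =
      (S i).indicator (1 : X → ℝ) (w k).1 - (S i).indicator (1 : X → ℝ) (w k).2 := by
    intro i k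
    simp [ha, hz, Set.indicator_apply]
  have hsub : (Finset.univ.filter fun σ : Fin n → Bool =>
      swapPairs σ w ∈ ⋃ i, selfNormalizedEvent (S i) c) ⊆
      𝒜.biUnion fun A => Finset.univ.filter fun σ : Fin n → Bool =>
        ∑ k, boolSign (σ k) * a A k ≠ 0 ∧
          c * ∑ k, a A k ^ 2 ≤ (∑ k, boolSign (σ k) * a A k) ^ 2 := by
    intro σ hσ
    obtain ⟨i, hi⟩ := Set.mem_iUnion.1 (Finset.mem_filter.1 hσ).2
    refine Finset.mem_biUnion.2 ⟨_, Finset.mem_image_of_mem _ (Finset.mem_univ i), ?_⟩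
    rw [Finset.mem_filter]
    simp only [hai]
    exact ⟨Finset.mem_univ _, (swapPairs_mem_selfNormalizedEvent (S i) c σ w).1 hi⟩
  calc _ ≤ ((∑ A ∈ 𝒜, (Finset.univ.filter fun σ : Fin n → Bool =>
        ∑ k, boolSign (σ k) * a A k ≠ 0 ∧
          c * ∑ k, a A k ^ 2 ≤ (∑ k, boolSign (σ k) * a A k) ^ 2).card : ℕ) : ℝ) :=
        Nat.cast_le.2 ((Finset.card_le_card hsub).trans Finset.card_biUnion_le)
    _ ≤ ∑ A ∈ 𝒜, 2 * (2 ^ n * Real.exp (-c / 2)) := by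
        rw [Nat.cast_sum]
        exact Finset.sum_le_sum fun A _ => by convert card_rademacher_sq_ge_le (a A) hc
    _ = 𝒜.card * (2 * (2 ^ n * Real.exp (-c / 2))) := by rw [Finset.sum_const, nsmul_eq_mul]
    _ ≤ K * (2 * (2 ^ n * Real.exp (-c / 2))) :=
        mul_le_mul_of_nonneg_right (Nat.cast_le.2 (hK z)) (by positivity)
    _ = _ := by ring

-- Each of the `2 ^ n` swaps preserves the product measure, so the measure of the event is the
-- integral of the fraction of swaps landing in it, which is bounded pointwise.
open scoped Classical in
theorem measure_iUnion_selfNormalizedEvent_le [MeasurableSpace X] (μ : Measure X)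
    [IsProbabilityMeasure μ] {n K : ℕ} (S : ι → Set X) (hS : ∀ i, MeasurableSet (S i))
    (hK : ∀ z : Fin n × Bool → X,
      (Finset.univ.image fun i => Finset.univ.filter fun j => z j ∈ S i).card ≤ K)
    {c : ℝ} (hc : 0 ≤ c) :
    Measure.pi (fun _ : Fin n => μ.prod μ) (⋃ i, selfNormalizedEvent (S i) c) ≤
      ENNReal.ofReal (2 * K * Real.exp (-c / 2)) := by
  set ν := Measure.pi (fun _ : Fin n => μ.prod μ)
  set B : Set (Fin n → X × X) := ⋃ i, selfNormalizedEvent (S i) c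
  have hB : MeasurableSet B :=
    MeasurableSet.iUnion fun i => measurableSet_selfNormalizedEvent (hS i) c
  have hσ : ∀ σ : Fin n → Bool, ∫⁻ w, B.indicator 1 (swapPairs σ w) ∂ν = ν B := fun σ => by
    rw [(measurePreserving_swapPairs μ σ).lintegral_comp (measurable_one.indicator hB),
      lintegral_indicator_one hB]
  have hsum : (2 : ENNReal) ^ n * ν B = ∫⁻ w, ∑ σ : Fin n → Bool,
      B.indicator 1 (swapPairs σ w) ∂ν := by
    rw [lintegral_finsetSum _ fun σ _ => show Measurable fun w =>
      B.indicator (1 : (Fin n → X × X) → ENNReal) (swapPairs σ w) from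
      (measurable_one.indicator hB).comp (measurePreserving_swapPairs μ σ).measurable]
    rw [Finset.sum_congr rfl fun σ _ => hσ σ]
    simp
  have hle : (2 : ENNReal) ^ n * ν B ≤
      2 ^ n * ENNReal.ofReal (2 * K * Real.exp (-c / 2)) := by
    rw [hsum]
    refine (lintegral_mono (g := fun _ => 2 ^ n * ENNReal.ofReal (2 * K * Real.exp (-c / 2)))
      fun w => ?_).trans_eq (by simp)
    have h1 : ∑ σ : Fin n → Bool, B.indicator (1 : (Fin n → X × X) → ENNReal) (swapPairs σ w) =
        ENNReal.ofReal ((Finset.univ.filter fun σ : Fin n → Bool => swapPairs σ w ∈ B).card) := by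
      rw [ENNReal.ofReal_natCast, Finset.card_filter, Nat.cast_sum]
      refine Finset.sum_congr rfl fun σ _ => ?_
      by_cases h : swapPairs σ w ∈ B <;> simp [h]
    have h2 : (2 : ENNReal) ^ n * ENNReal.ofReal (2 * K * Real.exp (-c / 2)) =
        ENNReal.ofReal (2 ^ n * (2 * K * Real.exp (-c / 2))) := by
      rw [ENNReal.ofReal_mul (p := 2 ^ n) (by positivity), ENNReal.ofReal_pow (by norm_num)]
      simp
    simp only
    rw [h1, h2]
    exact ENNReal.ofReal_le_ofReal (card_swapPairs_mem_le S hK hc w)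
  exact (ENNReal.mul_le_mul_iff_right (by simp) (by simp)).1 hle

/-- The half-width of the interval of admissible `VSTAT(m)` answers at expectation `p`. -/
noncomputable def vstatTolerance (m : ℕ) (p : ℝ) : ℝ :=
  max (1 / (m : ℝ)) (Real.sqrt (p * (1 - p) / m))

open scoped Classical in
/-- Uniform relative deviation of empirical frequencies over a finite family of sets with few
traces on finite samples. -/
theorem measure_exists_vstatTolerance_lt_le [MeasurableSpace X] (μ : Measure X)
    [IsProbabilityMeasure μ] {m n K : ℕ} (hm : 1 ≤ m) (hmn : 8 * m ≤ n)
    (S : ι → Set X) (hS : ∀ i, MeasurableSet (S i))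
    (hK : ∀ z : Fin n × Bool → X,
      (Finset.univ.image fun i => Finset.univ.filter fun j => z j ∈ S i).card ≤ K) :
    Measure.pi (fun _ : Fin n => μ)
      {s | ∃ i, vstatTolerance m (μ.real (S i)) < |empiricalFreq (S i) s - μ.real (S i)|} ≤
      ENNReal.ofReal (4 * K * Real.exp (-(n / (44 * m)))) := by
  have hn : 0 < n := by omega
  have hm0 : (0 : ℝ) < m := by exact_mod_cast hm
  have hn0 : (0 : ℝ) < n := by exact_mod_cast hn
  have hp0 : ∀ i, 0 ≤ μ.real (S i) := fun i => measureReal_nonneg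
  have hp1 : ∀ i, μ.real (S i) ≤ 1 := fun i => measureReal_le_one
  set t : ι → ℝ := fun i => vstatTolerance m (μ.real (S i)) with ht
  have ht1 : ∀ i, 1 / (m : ℝ) ≤ t i := fun i => le_max_left _ _
  have ht0 : ∀ i, 0 < t i := fun i => lt_of_lt_of_le (by positivity) (ht1 i)
  have ht2 : ∀ i, μ.real (S i) * (1 - μ.real (S i)) / m ≤ t i ^ 2 := fun i =>
    (Real.sqrt_le_left (ht0 i).le).1 (le_max_right _ _)
  set P := Measure.pi (fun _ : Fin n => μ) with hP
  set G : ι → Set (Fin n → X) := fun i => {s | t i < |empiricalFreq (S i) s - μ.real (S i)|}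
    with hG
  set H : ι → Set (Fin n → X) :=
    fun i => {s | |empiricalFreq (S i) s - μ.real (S i)| < t i / 2} with hH
  have hfm : ∀ i, Measurable fun s : Fin n → X => |empiricalFreq (S i) s - μ.real (S i)| :=
    fun i => ((measurable_empiricalFreq (hS i)).sub_const _).abs
  have hGm : ∀ i, MeasurableSet (G i) := fun i => measurableSet_lt measurable_const (hfm i)
  have hHm : ∀ i, MeasurableSet (H i) := fun i => measurableSet_lt (hfm i) measurable_const
  -- Chebyshev at `t i / 2` gives failure probability at most `4p(1 - p)/(n t²) ≤ 4m/n`, which is at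
  -- most `1/2` because `8m ≤ n`.
  have hHhalf : ∀ i, (1 / 2 : ENNReal) ≤ P (H i) := by
    intro i
    have h1 : P (H i)ᶜ ≤ 1 / 2 := by
      have hc : (H i)ᶜ = {s | t i / 2 ≤ |empiricalFreq (S i) s - μ.real (S i)|} := by
        ext s; simp [hH]
      rw [hc]
      refine (measure_empiricalFreq_sub_ge_le μ hn (hS i) (half_pos (ht0 i))).trans ?_
      rw [show (1 / 2 : ENNReal) = ENNReal.ofReal (1 / 2) by
        rw [ENNReal.ofReal_div_of_pos (by norm_num)]; simp]
      refine ENNReal.ofReal_le_ofReal ?_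
      have := ht2 i
      have := ht0 i
      have h8 : 8 * (m : ℝ) ≤ n := by exact_mod_cast hmn
      rw [div_le_iff₀ (by positivity)]
      rw [div_le_iff₀ hm0] at *
      nlinarith [sq_nonneg (t i)]
    rw [prob_compl_eq_one_sub (hHm i), tsub_le_iff_right] at h1
    refine (ENNReal.add_le_add_iff_left (a := 1 / 2) (by simp)).1 ?_
    rwa [ENNReal.add_halves]
  set A : Set (Fin n → X) := ⋃ i, G i with hA
  have hAm : MeasurableSet A := MeasurableSet.iUnion hGm
  set B : Set ((Fin n → X) × (Fin n → X)) := ⋃ i, G i ×ˢ H i with hB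
  have hBm : MeasurableSet B := MeasurableSet.iUnion fun i => (hGm i).prod (hHm i)
  -- Symmetrization: once the first sample has singled out a bad `i`, an independent second sample
  -- is good for that same `i` with probability at least `1/2`.
  have hAB : P A ≤ 2 * (P.prod P) B := by
    have h1 : P A * (1 / 2) ≤ (P.prod P) B := by
      rw [Measure.prod_apply hBm]
      calc P A * (1 / 2) = ∫⁻ s, A.indicator (fun _ => 1 / 2) s ∂P := by
            rw [lintegral_indicator_const hAm, mul_comm]
        _ ≤ _ := by
            refine lintegral_mono fun s => ?_
            by_cases hs : s ∈ A
            · rw [Set.indicator_of_mem hs]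
              obtain ⟨i, hi⟩ := Set.mem_iUnion.1 hs
              exact (hHhalf i).trans (measure_mono fun s' hs' =>
                Set.mem_iUnion.2 ⟨i, hi, hs'⟩)
            · rw [Set.indicator_of_notMem hs]; exact zero_le
    calc P A = 2 * (P A * (1 / 2)) := by
          rw [mul_comm, mul_assoc, one_div, ENNReal.inv_mul_cancel (by simp) (by simp), mul_one]
      _ ≤ _ := mul_le_mul_right h1 _
  set c : ℝ := n / (22 * m) with hc
  have hBle : (P.prod P) B ≤ ENNReal.ofReal (2 * K * Real.exp (-c / 2)) := by
    have hmp := measurePreserving_arrowProdEquivProdArrow X X (Fin n) (fun _ => μ) (fun _ => μ)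
    rw [← hmp.measure_preimage hBm.nullMeasurableSet]
    refine (measure_mono fun w hw => ?_).trans
      (measure_iUnion_selfNormalizedEvent_le μ S hS hK (c := c) (by positivity))
    obtain ⟨i, hi⟩ := Set.mem_iUnion.1 hw
    exact Set.mem_iUnion.2 ⟨i, sq_freq_sub_ge hm hn (ht1 i) (ht2 i) (hp0 i) (hp1 i) hi.1 hi.2⟩
  have hset : {s : Fin n → X | ∃ i, t i < |empiricalFreq (S i) s - μ.real (S i)|} = A := by
    ext s; simp [hA, hG]
  rw [hset]
  refine hAB.trans ((mul_le_mul_right hBle _).trans_eq ?_)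
  rw [show (2 : ENNReal) = ENNReal.ofReal 2 by simp, ← ENNReal.ofReal_mul (by norm_num)]
  congr 1
  have : -c / 2 = -(n / (44 * m) : ℝ) := by rw [hc]; field_simp; norm_num
  rw [this]; ring

end RelativeDeviation

/-! ### Nets of the unit ball -/

section Nets

variable {E : Type*} [NormedAddCommGroup E] [NormedSpace ℝ E] [FiniteDimensional ℝ E]

/-- Volume bound for separated subsets of the unit ball. -/
theorem card_le_of_separated_unitBall {ε : ℝ} (hε : 0 < ε) (s : Finset E)
    (hs : ∀ c ∈ s, ‖c‖ ≤ 1) (h : ∀ c ∈ s, ∀ e ∈ s, c ≠ e → ε ≤ ‖c - e‖) :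
    (s.card : ℝ) ≤ (1 + 2 / ε) ^ Module.finrank ℝ E := by
  borelize E
  let μ : Measure E := Measure.addHaar
  set δ : ℝ := ε / 2 with hδ
  set ρ : ℝ := 1 + ε / 2 with hρ
  have δpos : 0 < δ := half_pos hε
  have ρpos : 0 < ρ := by positivity
  set A := ⋃ c ∈ s, Metric.ball (c : E) δ with hA
  have D : Set.Pairwise (s : Set E) (Function.onFun Disjoint fun c => Metric.ball (c : E) δ) := by
    rintro c hc e he hce
    apply Metric.ball_disjoint_ball
    rw [dist_eq_norm]
    linarith [h c hc e he hce]
  have A_subset : A ⊆ Metric.ball (0 : E) ρ := by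
    refine Set.iUnion₂_subset fun x hx => ?_
    apply Metric.ball_subset_ball'
    rw [dist_zero_right]
    linarith [hs x hx]
  have I : (s.card : ENNReal) * ENNReal.ofReal (δ ^ Module.finrank ℝ E) * μ (Metric.ball 0 1) ≤
      ENNReal.ofReal (ρ ^ Module.finrank ℝ E) * μ (Metric.ball 0 1) :=
    calc _ = μ A := by
          rw [hA, measure_biUnion_finset D fun c _ => measurableSet_ball]
          simp only [μ.addHaar_ball_of_pos _ δpos, Finset.sum_const, nsmul_eq_mul, mul_assoc]
      _ ≤ μ (Metric.ball (0 : E) ρ) := measure_mono A_subset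
      _ = _ := by simp only [μ.addHaar_ball_of_pos _ ρpos]
  have J : (s.card : ENNReal) * ENNReal.ofReal (δ ^ Module.finrank ℝ E) ≤
      ENNReal.ofReal (ρ ^ Module.finrank ℝ E) :=
    (ENNReal.mul_le_mul_iff_left (Metric.measure_ball_pos _ _ zero_lt_one).ne'
      measure_ball_lt_top.ne).1 I
  have K := ENNReal.toReal_le_of_le_ofReal (pow_nonneg ρpos.le _) J
  rw [ENNReal.toReal_mul, ENNReal.toReal_natCast, ENNReal.toReal_ofReal (by positivity)] at K
  have hr : (1 + 2 / ε) ^ Module.finrank ℝ E * δ ^ Module.finrank ℝ E =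
      ρ ^ Module.finrank ℝ E := by
    rw [← mul_pow]; congr 1; rw [hδ, hρ]; field_simp; ring
  exact le_of_mul_le_mul_right (K.trans_eq hr.symm) (by positivity)

/-- A separated subset of largest cardinality is a net, since an uncovered point could be added to
it; the volume bound guarantees that a largest one exists. -/
theorem exists_unitBall_net {ε : ℝ} (hε : 0 < ε) :
    ∃ s : Finset E, (∀ c ∈ s, ‖c‖ ≤ 1) ∧ (∀ x : E, ‖x‖ ≤ 1 → ∃ c ∈ s, ‖c - x‖ ≤ ε) ∧
      (s.card : ℝ) ≤ (1 + 2 / ε) ^ Module.finrank ℝ E := by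
  classical
  let Q : ℕ → Prop := fun k => ∃ s : Finset E, s.card = k ∧ (∀ c ∈ s, ‖c‖ ≤ 1) ∧
    ∀ c ∈ s, ∀ e ∈ s, c ≠ e → ε ≤ ‖c - e‖
  set N := ⌊(1 + 2 / ε) ^ Module.finrank ℝ E⌋₊
  have hQ : ∀ k, Q k → k ≤ N := by
    rintro _ ⟨s, rfl, h1, h2⟩
    exact Nat.le_floor (card_le_of_separated_unitBall hε s h1 h2)
  have hQ0 : Q 0 := ⟨∅, by simp⟩
  obtain ⟨s, hcard, h1, h2⟩ := Nat.findGreatest_spec (Nat.zero_le N) hQ0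
  refine ⟨s, h1, fun x hx => ?_, card_le_of_separated_unitBall hε s h1 h2⟩
  by_contra! hfar
  have hxs : x ∉ s := fun h => by
    have := hfar x h
    simp at this
    linarith
  have hins : Q (s.card + 1) := by
    refine ⟨insert x s, Finset.card_insert_of_notMem hxs, ?_, ?_⟩
    · simpa [hx] using h1
    · intro c hc e he hce
      rcases Finset.mem_insert.1 hc with hcx | hcs <;>
        rcases Finset.mem_insert.1 he with hex | hes
      · exact absurd (hcx.trans hex.symm) hce
      · rw [hcx, norm_sub_rev]; exact (hfar e hes).le
      · rw [hex]; exact (hfar c hcs).le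
      · exact h2 c hcs e hes hce
  have := Nat.le_findGreatest (hQ _ hins) hins
  omega

end Nets

/-! ### Slab probabilities -/

section Slabs

variable {d : ℕ}

/-- The slab `{(x, y) : |xᵀb - y| ≤ η}`. -/
def slab (b : Covariate d) (η : ℝ) : Set (Example d) := {p | |inner ℝ p.1 b - p.2| ≤ η}

theorem measurableSet_slab (b : Covariate d) (η : ℝ) : MeasurableSet (slab b η) := by
  refine measurableSet_le ?_ measurable_const
  fun_prop

theorem measurable_obliviousLaw_map (β : Covariate d) :
    Measurable fun p : Covariate d × ℝ => (p.1, inner ℝ p.1 β + p.2) := by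
  fun_prop

instance isProbabilityMeasure_obliviousLaw (β : Covariate d) (E : Measure ℝ)
    [IsProbabilityMeasure E] : IsProbabilityMeasure (obliviousLaw β E) :=
  Measure.isProbabilityMeasure_map (measurable_obliviousLaw_map β).aemeasurable

theorem obliviousLaw_slab (β b : Covariate d) (E : Measure ℝ) [IsProbabilityMeasure E] (η : ℝ) :
    obliviousLaw β E (slab b η) =
      ∫⁻ z, stdGaussian (Covariate d) {x | |inner ℝ (b - β) x - z| ≤ η} ∂E := by
  rw [obliviousLaw, Measure.map_apply (measurable_obliviousLaw_map β) (measurableSet_slab b η),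
    Measure.prod_apply_symm (measurable_obliviousLaw_map β (measurableSet_slab b η))]
  refine lintegral_congr fun z => congrArg _ ?_
  ext x
  have : inner ℝ x b - (inner ℝ x β + z) = inner ℝ (b - β) x - z := by
    rw [inner_sub_left, real_inner_comm, real_inner_comm x β]; ring
  simp [slab, this]

/-- Chebyshev with variance `‖u‖² ≤ η²/4`; this also covers the degenerate case `u = 0`. -/
theorem stdGaussian_abs_inner_le_ge {u : Covariate d} {η : ℝ} (hη : 0 < η) (hu : ‖u‖ ≤ η / 2) :
    ENNReal.ofReal (3 / 4) ≤ stdGaussian (Covariate d) {x | |inner ℝ u x| ≤ η} := by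
  set γ := stdGaussian (Covariate d)
  have hL : MemLp (innerSL ℝ u) 2 γ := (IsGaussian.memLp_two_id (μ := γ)).continuousLinearMap_comp
    (innerSL ℝ u)
  have h := meas_ge_le_variance_div_sq hL hη
  rw [variance_dual_stdGaussian, integral_strongDual_stdGaussian, innerSL_apply_norm] at h
  simp only [sub_zero, innerSL_apply_apply] at h
  have h1 : γ {x | |inner ℝ u x| ≤ η}ᶜ ≤ ENNReal.ofReal (1 / 4) := by
    refine (measure_mono fun x hx => ?_).trans (h.trans (ENNReal.ofReal_le_ofReal ?_))
    · simp only [Set.mem_compl_iff, Set.mem_ofPred_eq, not_le] at hx ⊢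
      exact hx.le
    · rw [div_le_iff₀ (by positivity)]
      nlinarith [norm_nonneg u]
  have hm : MeasurableSet {x : Covariate d | |inner ℝ u x| ≤ η} :=
    measurableSet_le (by fun_prop) measurable_const
  rw [prob_compl_eq_one_sub hm, tsub_le_iff_right] at h1
  refine (ENNReal.add_le_add_iff_left (a := ENNReal.ofReal (1 / 4)) ENNReal.ofReal_ne_top).1 ?_
  rw [← ENNReal.ofReal_add (by norm_num) (by norm_num)]
  norm_num at h1 ⊢
  exact h1

/-- The projection is `N(0, ‖u‖²)`, whose density is at most `1/(2‖u‖)` since `2π ≥ 4`; the window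
has length `2η`. Uniformity in `z` is what makes the noise law irrelevant. -/
theorem stdGaussian_abs_inner_sub_le {u : Covariate d} (hu : u ≠ 0) (η z : ℝ) :
    stdGaussian (Covariate d) {x | |inner ℝ u x - z| ≤ η} ≤ ENNReal.ofReal (η / ‖u‖) := by
  set γ := stdGaussian (Covariate d)
  have hr : 0 < ‖u‖ := norm_pos_iff.2 hu
  set v : NNReal := (‖u‖ ^ 2).toNNReal with hv
  have hv0 : v ≠ 0 := by
    rw [hv, Ne, Real.toNNReal_eq_zero, not_le]; positivity
  have hmap : γ.map (innerSL ℝ u) = gaussianReal 0 v := by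
    rw [IsGaussian.map_eq_gaussianReal, variance_dual_stdGaussian,
      integral_strongDual_stdGaussian, innerSL_apply_norm]
  have hset : {x : Covariate d | |inner ℝ u x - z| ≤ η} =
      innerSL ℝ u ⁻¹' Set.Icc (z - η) (z + η) := by
    ext x
    simp only [Set.mem_ofPred_eq, Set.mem_preimage, innerSL_apply_apply, Set.mem_Icc, abs_le]
    constructor <;> rintro ⟨h, h'⟩ <;> constructor <;> linarith
  rw [hset, ← Measure.map_apply (innerSL ℝ u).measurable measurableSet_Icc, hmap,
    gaussianReal_apply 0 hv0]
  have hpdf : ∀ x, gaussianPDF 0 v x ≤ ENNReal.ofReal ((2 * ‖u‖)⁻¹) := fun x => by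
    refine ENNReal.ofReal_le_ofReal ?_
    rw [gaussianPDFReal]
    have hvr : (v : ℝ) = ‖u‖ ^ 2 := Real.coe_toNNReal _ (by positivity)
    have h2 : 2 * ‖u‖ ≤ Real.sqrt (2 * Real.pi * v) := by
      refine Real.le_sqrt_of_sq_le ?_
      rw [hvr]
      nlinarith [Real.pi_gt_three, sq_nonneg ‖u‖]
    calc _ ≤ (Real.sqrt (2 * Real.pi * v))⁻¹ * 1 := by
          refine mul_le_mul_of_nonneg_left (Real.exp_le_one_iff.2 ?_) (by positivity)
          exact div_nonpos_of_nonpos_of_nonneg (by nlinarith [sq_nonneg (x - 0)]) (by positivity)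
      _ ≤ _ := by
          rw [mul_one]
          exact inv_anti₀ (by positivity) h2
  calc ∫⁻ x in Set.Icc (z - η) (z + η), gaussianPDF 0 v x
      ≤ ∫⁻ x in Set.Icc (z - η) (z + η), ENNReal.ofReal ((2 * ‖u‖)⁻¹) := lintegral_mono hpdf
    _ = ENNReal.ofReal ((2 * ‖u‖)⁻¹) * ENNReal.ofReal (z + η - (z - η)) := by
        rw [setLIntegral_const, Real.volume_Icc]
    _ = ENNReal.ofReal (η / ‖u‖) := by
        rw [← ENNReal.ofReal_mul (by positivity)]
        congr 1
        field_simp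
        ring

theorem le_obliviousLaw_real_slab {β b : Covariate d} {E : Measure ℝ} [IsProbabilityMeasure E]
    {η α : ℝ} (hη : 0 < η) (hE : ENNReal.ofReal α ≤ E {0}) (hb : ‖b - β‖ ≤ η / 2) :
    3 / 4 * α ≤ (obliviousLaw β E).real (slab b η) := by
  refine (ENNReal.ofReal_le_iff_le_toReal (measure_ne_top _ _)).1 ?_
  rw [obliviousLaw_slab]
  calc ENNReal.ofReal (3 / 4 * α)
      ≤ stdGaussian (Covariate d) {x | |inner ℝ (b - β) x - 0| ≤ η} * E {0} := by
        rw [ENNReal.ofReal_mul (by norm_num)]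
        simp only [sub_zero]
        exact mul_le_mul' (stdGaussian_abs_inner_le_ge hη hb) hE
    _ = ∫⁻ z in {0}, stdGaussian (Covariate d) {x | |inner ℝ (b - β) x - z| ≤ η} ∂E := by
        rw [lintegral_singleton]
    _ ≤ _ := setLIntegral_le_lintegral _ _

theorem obliviousLaw_real_slab_le {β b : Covariate d} {E : Measure ℝ} [IsProbabilityMeasure E]
    {η : ℝ} (hη : 0 ≤ η) (hb : b ≠ β) :
    (obliviousLaw β E).real (slab b η) ≤ η / ‖b - β‖ := by
  refine ENNReal.toReal_le_of_le_ofReal (by positivity) ?_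
  rw [obliviousLaw_slab]
  refine (lintegral_mono fun z => stdGaussian_abs_inner_sub_le (sub_ne_zero.2 hb) η z).trans ?_
  simp

end Slabs

/-! ### The algorithm -/

section NetAlgorithm

variable {d : ℕ}

/-- The indicator query of a slab. -/
noncomputable def slabQuery (b : Covariate d) (η : ℝ) : StatQuery (Example d) where
  toFun := intervalIndicator b η
  measurable_toFun := measurable_one.indicator (measurableSet_slab b η)
  nonneg := Set.indicator_nonneg fun _ _ => zero_le_one
  le_one := Set.indicator_le_self' (f := (1 : Example d → ℝ)) (fun _ _ => zero_le_one)

theorem integral_slabQuery (μ : Measure (Example d)) (b : Covariate d) (η : ℝ) :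
    ∫ x, (slabQuery b η).toFun x ∂μ = μ.real (slab b η) :=
  integral_indicator_one (measurableSet_slab b η)

theorem isVSTATAnswer_slabQuery_iff (μ : Measure (Example d)) (m : ℕ) (b : Covariate d) (η v : ℝ) :
    IsVSTATAnswer μ m (slabQuery b η) v ↔
      |v - μ.real (slab b η)| ≤ vstatTolerance m (μ.real (slab b η)) := by
  rw [IsVSTATAnswer, integral_slabQuery, vstatTolerance]

/-- Query the slabs around the points `b i` and output a point with the largest answer. -/
noncomputable def netAlgorithm {q : ℕ} [Nonempty (Fin q)] (b : Fin q → Covariate d) (η : ℝ) :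
    SQAlgorithm (Example d) (Covariate d) where
  numQueries := q
  query i _ := slabQuery (b i) η
  output v := b (Finite.exists_max v).choose

theorem netAlgorithm_output {q : ℕ} [Nonempty (Fin q)] (b : Fin q → Covariate d) (η : ℝ)
    (v : Fin q → ℝ) : ∃ j, (netAlgorithm b η).output v = b j ∧ ∀ i, v i ≤ v j :=
  ⟨_, rfl, (Finite.exists_max v).choose_spec⟩

theorem netAlgorithm_maximizesOverNet {q : ℕ} [Nonempty (Fin q)] {b : Fin q → Covariate d} {η : ℝ}
    (hb : ∀ i, ‖b i‖ ≤ 1) (hnet : ∀ β : Covariate d, ‖β‖ ≤ 1 → ∃ i, ‖b i - β‖ ≤ η) :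
    (netAlgorithm b η).MaximizesOverNet η :=
  ⟨b, hb, hnet, fun _ _ => rfl, netAlgorithm_output b η⟩

theorem vstatTolerance_le_of_le {m : ℕ} {α p : ℝ} (hα : 0 < α) (hm : 100 / α ≤ m)
    (hp : p ≤ α / 100) (hp0 : 0 ≤ p) : vstatTolerance m p ≤ α / 100 := by
  have hm0 : (0 : ℝ) < m := lt_of_lt_of_le (by positivity) hm
  rw [div_le_iff₀ hα] at hm
  refine max_le ?_ (Real.sqrt_le_iff.2 ⟨by positivity, ?_⟩)
  · rw [div_le_iff₀ hm0]; nlinarith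
  · rw [div_le_iff₀ hm0]
    nlinarith

/-- Here `p * m ≥ 75`, so `1/m ≤ p/75` and `p(1 - p)/m ≤ p²/75 ≤ (p/5)²`. -/
theorem vstatTolerance_le_of_ge {m : ℕ} {α p : ℝ} (hα : 0 < α) (hm : 100 / α ≤ m)
    (hp : 3 / 4 * α ≤ p) : vstatTolerance m p ≤ p / 5 := by
  have hm0 : (0 : ℝ) < m := lt_of_lt_of_le (by positivity) hm
  have hp0 : 0 < p := lt_of_lt_of_le (by positivity) hp
  rw [div_le_iff₀ hα] at hm
  have hpm : 75 ≤ p * m := by nlinarith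
  refine max_le ?_ (Real.sqrt_le_iff.2 ⟨by positivity, ?_⟩)
  · rw [div_le_iff₀ hm0]; nlinarith
  · rw [div_le_iff₀ hm0]
    nlinarith

/-- A net point within `τα/2` of `β` gets an answer of at least `(4/5)(3/4)α = 3α/5`, a point
farther than `100τ` at most `α/100 + α/100`. -/
theorem netAlgorithm_output_close {q : ℕ} [Nonempty (Fin q)] {b : Fin q → Covariate d}
    {m : ℕ} {α τ : ℝ} (hα : 0 < α) (hτ : 0 < τ) (hm : 100 / α ≤ m)
    (hnet : ∀ β : Covariate d, ‖β‖ ≤ 1 → ∃ i, ‖b i - β‖ ≤ τ * α / 2)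
    {β : Covariate d} {E : Measure ℝ} [IsProbabilityMeasure E] (hβ : ‖β‖ ≤ 1)
    (hE : ENNReal.ofReal α ≤ E {0}) (v : Fin q → ℝ)
    (hv : (netAlgorithm b (τ * α)).IsVSTATTranscript (obliviousLaw β E) m v) :
    ‖(netAlgorithm b (τ * α)).output v - β‖ ≤ 100 * τ := by
  obtain ⟨j, hj, hmax⟩ := netAlgorithm_output b (τ * α) v
  rw [hj]
  by_contra! hfar
  obtain ⟨i, hi⟩ := hnet β hβ
  have hη : 0 < τ * α := by positivity
  have hvi := (isVSTATAnswer_slabQuery_iff _ m (b i) (τ * α) (v i)).1 (hv i)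
  have hvj := (isVSTATAnswer_slabQuery_iff _ m (b j) (τ * α) (v j)).1 (hv j)
  have hpi := le_obliviousLaw_real_slab hη hE hi
  have hr : 0 < ‖b j - β‖ := lt_trans (by positivity) hfar
  have hpj : (obliviousLaw β E).real (slab (b j) (τ * α)) ≤ α / 100 := by
    refine (obliviousLaw_real_slab_le hη.le (sub_ne_zero.1 (norm_pos_iff.1 hr))).trans ?_
    rw [div_le_iff₀ hr]
    nlinarith
  have t1 := vstatTolerance_le_of_ge hα hm hpi
  have t2 := vstatTolerance_le_of_le hα hm hpj measureReal_nonneg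
  have a1 := (abs_le.1 (hvi.trans t1)).1
  have a2 := (abs_le.1 (hvj.trans t2)).2
  have := hmax i
  linarith

/-- The sample size suffices for the union bound over the traces of the slabs. -/
theorem trace_bound_mul_exp_le {m n : ℕ} {α δ : ℝ} (hd : 1 ≤ d) (hα : 0 < α) (hα1 : α < 1)
    (hδ : 0 < δ) (hδ1 : δ < 1) (hm : 1 ≤ m) (hmα : (m : ℝ) ≤ 101 / α)
    (hn : 1000000 * (d * Real.log (2 / α) + Real.log (1 / δ)) / α ≤ n) :
    8 * m ≤ n ∧
    4 * (((∑ k ∈ Finset.Iic d, (2 * n).choose k) ^ 2 : ℕ) : ℝ) * Real.exp (-(n / (44 * m))) ≤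
      δ := by
  have hd1 : (1 : ℝ) ≤ d := by exact_mod_cast hd
  have hd0 : (0 : ℝ) < d := by linarith
  have hm0 : (0 : ℝ) < m := by exact_mod_cast hm
  set L := Real.log (2 / α) with hL
  set D := Real.log (1 / δ) with hD
  have hD0 : 0 ≤ D := Real.log_nonneg (by rw [le_div_iff₀ hδ]; linarith)
  have hL2 : Real.log 2 ≤ L := Real.log_le_log (by norm_num) (by rw [le_div_iff₀ hα]; linarith)
  have hlog2 := Real.log_two_gt_d9
  rw [div_le_iff₀ hα] at hn
  have hdL : (d : ℝ) * (1 / 2) ≤ d * L := mul_le_mul_of_nonneg_left (by linarith) hd0.le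
  have hnα : 500000 * (d : ℝ) ≤ n * α := by nlinarith
  have hn0 : (0 : ℝ) < n := by
    by_contra! h
    nlinarith
  have hmα' : (m : ℝ) * α ≤ 101 := by rwa [le_div_iff₀ hα] at hmα
  have h8 : 8 * m ≤ n := by
    have : 8 * (m : ℝ) ≤ n := by
      refine le_of_mul_le_mul_right ?_ hα
      linarith
    exact_mod_cast this
  have hdn : d ≤ 2 * n := by
    have : (d : ℝ) ≤ n := by nlinarith
    have : d ≤ n := by exact_mod_cast this
    omega
  refine ⟨h8, ?_⟩
  have hK := sum_choose_le_exp_pow hd hdn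
  set K : ℕ := ∑ k ∈ Finset.Iic d, (2 * n).choose k
  push_cast at hK ⊢
  set x : ℝ := Real.exp 1 * (2 * n) / d with hx
  have hx0 : 0 < x := by positivity
  -- The factor `2 ^ 16` is split off before `log y ≤ y - 1` is applied. It costs only `16 log 2 ≤
  -- 16 L`, and it makes the linear term so small that, after multiplication by `2d`, it is `nα / 2
  -- ^ 15`, well below the exponent `nα / 4444` (where `4444 = 44 * 101`).
  have hlogx : Real.log x ≤ 2 * n * α / (2 ^ 17 * d) + 17 * L := by
    have e1 : x = Real.exp 1 * ((2 ^ 16 * (2 / α)) * (2 * n * α / (2 ^ 17 * d))) := by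
      rw [hx]; field_simp
    rw [e1, Real.log_mul (by positivity) (by positivity),
      Real.log_mul (by positivity) (by positivity), Real.log_mul (by positivity) (by positivity),
      Real.log_exp, Real.log_pow, ← hL]
    have := Real.log_le_sub_one_of_pos (x := 2 * n * α / (2 ^ 17 * d)) (by positivity)
    push_cast
    linarith
  have hdlog : 2 * d * Real.log x ≤ n * α / 2 ^ 15 + 34 * (d * L) := by
    have := mul_le_mul_of_nonneg_left hlogx (show (0 : ℝ) ≤ 2 * d by positivity)
    refine this.trans_eq ?_
    field_simp
    ring
  have hexp : (n : ℝ) * α / 4444 ≤ n / (44 * m) := by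
    rw [div_le_div_iff₀ (by norm_num) (by positivity)]
    nlinarith
  have hfinal : Real.log 4 + 2 * d * Real.log x + -(n / (44 * m) : ℝ) ≤ -D := by
    have h4 : Real.log 4 = 2 * Real.log 2 := by
      rw [show (4 : ℝ) = 2 ^ 2 by norm_num, Real.log_pow]; norm_num
    have hLdL : L ≤ d * L := le_mul_of_one_le_left (by linarith) hd1
    rw [h4]
    linarith
  calc 4 * (K : ℝ) ^ 2 * Real.exp (-(n / (44 * m)))
      ≤ 4 * (x ^ d) ^ 2 * Real.exp (-(n / (44 * m))) := by gcongr
    _ = Real.exp (Real.log 4 + 2 * d * Real.log x + -(n / (44 * m))) := by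
        rw [Real.exp_add, Real.exp_add, Real.exp_log (by norm_num), ← pow_mul,
          ← Real.exp_log hx0, ← Real.exp_nat_mul, Real.log_exp]
        congr 3
        push_cast
        ring
    _ ≤ Real.exp (-D) := Real.exp_le_exp.2 hfinal
    _ = δ := by rw [hD, one_div, Real.log_inv, neg_neg, Real.exp_log hδ]

/-- The number `q` of queries and the width `η` do not enter the sample size: only the trace count
on `2n` points does. -/
theorem measure_not_isVSTATTranscript_le {q : ℕ} [Nonempty (Fin q)] (b : Fin q → Covariate d)
    (η : ℝ) (μ : Measure (Example d)) [IsProbabilityMeasure μ]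
    {m n : ℕ} {α δ : ℝ} (hd : 1 ≤ d) (hα : 0 < α) (hα1 : α < 1)
    (hδ : 0 < δ) (hδ1 : δ < 1) (hm : 1 ≤ m) (hmα : (m : ℝ) ≤ 101 / α)
    (hn : 1000000 * (d * Real.log (2 / α) + Real.log (1 / δ)) / α ≤ n) :
    Measure.pi (fun _ : Fin n => μ)
      {s | ¬ (netAlgorithm b η).IsVSTATTranscript μ m ((netAlgorithm b η).run (empiricalMean s))} ≤
      ENNReal.ofReal δ := by
  classical
  obtain ⟨h8, hbound⟩ := trace_bound_mul_exp_le hd hα hα1 hδ hδ1 hm hmα hn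
  have hK : ∀ z : Fin n × Bool → Example d,
      (Finset.univ.image fun i => Finset.univ.filter fun j => z j ∈ slab (b i) η).card ≤
      (∑ k ∈ Finset.Iic d, (2 * n).choose k) ^ 2 := fun z => by
    have := card_slab_traces_le b (fun j => (z j).1) (fun j => (z j).2) η
    rw [finrank_euclideanSpace_fin, Fintype.card_prod, Fintype.card_fin, Fintype.card_bool,
      mul_comm n 2] at this
    convert this
    rfl
  have h := measure_exists_vstatTolerance_lt_le μ hm h8 (fun i => slab (b i) η)
    (fun i => measurableSet_slab (b i) η) (fun z => by convert hK z)
  refine (measure_mono fun s hs => ?_).trans (h.trans (ENNReal.ofReal_le_ofReal hbound))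
  simp only [Set.mem_ofPred_eq, SQAlgorithm.IsVSTATTranscript, not_forall] at hs ⊢
  obtain ⟨i, hi⟩ := hs
  refine ⟨i, ?_⟩
  rw [SQAlgorithm.run_apply] at hi
  have := mt (isVSTATAnswer_slabQuery_iff μ m (b i) η _).2 hi
  exact not_le.1 this

end NetAlgorithm

theorem one_add_four_div_pow_le_exp {d : ℕ} {x : ℝ} (hx0 : 0 < x) (hx : x ≤ 1 / 2) :
    (1 + 2 / (x / 2)) ^ d ≤ Real.exp (1000000 * (d * Real.log (1 / x))) := by
  have hl : 0 ≤ Real.log (1 / x) := Real.log_nonneg (by rw [le_div_iff₀ hx0]; linarith)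
  have h1 : 1 + 2 / (x / 2) ≤ (1 / x) ^ 4 := by
    rw [one_div, inv_pow, ← one_div, le_div_iff₀ (by positivity)]
    have : (1 + 2 / (x / 2)) * x ^ 4 = x ^ 4 + 4 * x ^ 3 := by field_simp; ring
    rw [this]
    have h3 : x ^ 3 ≤ (1 / 2) ^ 3 := pow_le_pow_left₀ hx0.le hx 3
    have h4 : x ^ 4 ≤ (1 / 2) ^ 4 := pow_le_pow_left₀ hx0.le hx 4
    linarith
  calc (1 + 2 / (x / 2)) ^ d ≤ ((1 / x) ^ 4) ^ d := pow_le_pow_left₀ (by positivity) h1 d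
    _ = Real.exp (4 * (d * Real.log (1 / x))) := by
        rw [← pow_mul, ← Real.exp_log (show 0 < 1 / x by positivity), ← Real.exp_nat_mul,
          Real.log_exp]
        congr 1
        push_cast
        ring
    _ ≤ _ := Real.exp_le_exp.2 (mul_le_mul_of_nonneg_right (by norm_num) (by positivity))

theorem mainTheorem7 :
    ∃ C : ℝ, 0 < C ∧
      ∀ (d : ℕ) (α τ : ℝ), 1 ≤ d → 0 < α → α < 1 → 0 < τ → τ * α ≤ 1 →
        ∃ (m : ℕ) (η : ℝ) (A : SQAlgorithm (Example d) (Covariate d)),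
          1 ≤ m ∧ (m : ℝ) ≤ C / α ∧
          0 < η ∧ η ≤ C * τ * α ∧ A.MaximizesOverNet η ∧
          (A.numQueries : ℝ) ≤ Real.exp (C * (d * Real.log (1 / (τ * α)))) ∧
          ∀ (β : Covariate d) (E : Measure ℝ), ‖β‖ ≤ 1 → IsProbabilityMeasure E →
            ENNReal.ofReal α ≤ E {0} →
            (∀ v, A.IsVSTATTranscript (obliviousLaw β E) m v → ‖A.output v - β‖ ≤ C * τ) ∧
            ∀ (δ : ℝ) (n : ℕ), 0 < δ → δ < 1 →
              C * (d * Real.log (2 / α) + Real.log (1 / δ)) / α ≤ n →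
              Measure.pi (fun _ : Fin n => obliviousLaw β E)
                {s | ¬ A.IsVSTATTranscript (obliviousLaw β E) m (A.run (empiricalMean s))} ≤
                ENNReal.ofReal δ := by
  refine ⟨1000000, by norm_num, fun d α τ hd hα hα1 hτ hτα => ?_⟩
  set m := ⌈100 / α⌉₊ with hmdef
  have hm100 : 100 / α ≤ m := Nat.le_ceil _
  have hm1 : 1 ≤ m := Nat.one_le_ceil_iff.2 (by positivity)
  have hmα : (m : ℝ) ≤ 101 / α := by
    refine (Nat.ceil_lt_add_one (by positivity)).le.trans ?_
    rw [div_add_one hα.ne']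
    gcongr
    linarith
  have hmC : (m : ℝ) ≤ 1000000 / α := hmα.trans (by gcongr; norm_num)
  have hx : 0 < τ * α := by positivity
  -- As `τα` approaches `1` the query budget shrinks to `1`, too small for a fine net. In that range
  -- `α < 1` gives `τ ≥ 1/2`, so the single centre `0` with `η = 1` is accurate enough.
  rcases le_total (1 / 2) (τ * α) with hlarge | hsmall
  · refine ⟨m, 1, netAlgorithm (fun _ : Fin 1 => (0 : Covariate d)) 1, hm1, hmC, one_pos,
      by linarith, netAlgorithm_maximizesOverNet (by simp) (fun β hβ => ⟨0, by simpa using hβ⟩),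
      ?_, fun β E hβ hEp hE => ⟨fun v _ => ?_, fun δ n hδ hδ1 hn => ?_⟩⟩
    · have : 0 ≤ Real.log (1 / (τ * α)) := Real.log_nonneg (by rwa [le_div_iff₀ hx, one_mul])
      simpa [netAlgorithm] using Real.one_le_exp (x := 1000000 * (d * Real.log (1 / (τ * α))))
        (by positivity)
    · have hτ2 : 1 / 2 ≤ τ := by nlinarith
      have : ‖(0 : Covariate d) - β‖ ≤ 1000000 * τ := by
        rw [zero_sub, norm_neg]; linarith
      exact this
    · exact measure_not_isVSTATTranscript_le _ 1 _ hd hα hα1 hδ hδ1 hm1 hmα hn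
  -- The net is twice as fine as the half-width `τα` of the queries, as the Chebyshev bound at the
  -- nearest net point requires.
  · obtain ⟨s, hs1, hsnet, hscard⟩ := exists_unitBall_net (E := Covariate d) (half_pos hx)
    obtain ⟨c₀, hc₀, -⟩ := hsnet 0 (by simp)
    set b : Fin s.card → Covariate d := fun i => (s.equivFin.symm i : Covariate d) with hb
    have hnet : ∀ β : Covariate d, ‖β‖ ≤ 1 → ∃ i, ‖b i - β‖ ≤ τ * α / 2 := fun β hβ => by
      obtain ⟨c, hc, hcβ⟩ := hsnet β hβ
      exact ⟨s.equivFin ⟨c, hc⟩, by simpa [hb] using hcβ⟩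
    have : Nonempty (Fin s.card) := ⟨s.equivFin ⟨c₀, hc₀⟩⟩
    refine ⟨m, τ * α, netAlgorithm b (τ * α), hm1, hmC, hx, by nlinarith,
      netAlgorithm_maximizesOverNet (fun i => hs1 _ (s.equivFin.symm i).2)
        (fun β hβ => (hnet β hβ).imp fun i hi => hi.trans (by linarith)),
      ?_, fun β E hβ hEp hE => ⟨fun v hv => ?_, fun δ n hδ hδ1 hn => ?_⟩⟩
    · rw [finrank_euclideanSpace_fin] at hscard
      exact hscard.trans (one_add_four_div_pow_le_exp hx hsmall)
    · exact (netAlgorithm_output_close hα hτ hm100 hnet hβ hE v hv).trans (by linarith)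
    · exact measure_not_isVSTATTranscript_le b _ _ hd hα hα1 hδ hδ1 hm1 hmα hn
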